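/- Let $m\ge 2$, $d\ge 3$ and $n$ be integers, and let $K$ be an infinite field whose characteristic is zero or greater than $d$. Let $R=K[x_0,\dots,x_n,y_1,\dots,y_m]$ act by contraction on the divided power algebra $S=K_{\mathrm{DP}}[X_0,\dots,X_n,Y_1,\dots,Y_m]$, that is, a variable of $R$ lowers the exponent of the corresponding variable in a (divided power) monomial by one, and kills the monomial if that exponent is $0$. Let $$F=X_0P_0+\cdots+X_nP_n+G\in S_d$$ be a full Perazzo form: $P_0,\dots,P_n$ is a basis of the space $K_{\mathrm{DP}}[Y_1,\dots,Y_m]_{d-1}$ of forms of degree $d-1$, and $G$ is a form of degree $d$ in $K_{\mathrm{DP}}[Y_1,\dots,Y_m]$. Let $A_F=R/\operatorname{Ann}_R(F)$, where $\operatorname{Ann}_R(F)=\{f\in R: f\circ F=0\}$, be the corresponding full Perazzo algebra. For a linear form $\ell\in[A_F]_1$ let $P_{\ell,A_F}$ be its Jordan type, i.e. the partition of $\dim_K A_F$ whose parts are the sizes of the Jordan blocks of the multiplication map $\times\ell:A_F\to A_F$. The generic linear Jordan type $P_{A_F}$ is the maximum, with respect to the dominance order of partitions, of the Jordan types $P_{\ell,A_F}$,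 $\ell\in[A_F]_1$. Then $n+1=\binom{d+m-2}{m-1}$, the generic linear Jordan type $P_{A_F}$ exists and is unique, and it has exactly $2(n+1)$ parts. -/

import Mathlib

noncomputable section

namespace Perazzo

open Module

/-! ## The divided power algebra and the contraction action -/

/-- The `K`-vector space underlying the divided power algebra `K_DP[X_s : s ∈ σ]`. The basis vector
`Finsupp.single a 1` is the divided power monomial `X^[a] = ∏ X_s^[a s]`. -/
abbrev DP (K : Type*) [Field K] (σ : Type*) := (σ →₀ ℕ) →₀ K

variable {K : Type*} [Field K] {σ : Type*}

/-- Multiplication of the divided power algebra: `X^[a] * X^[b] = (∏ s, (a s + b s).choose (a s)) X^[a + b]`,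
extended bilinearly. -/
def dpMul (f g : DP K σ) : DP K σ :=
  f.sum fun a r => g.sum fun b t =>
    Finsupp.single (a + b) ((((a + b).prod fun s k => k.choose (a s) : ℕ) : K) * (r * t))

/-- The forms of degree `e` in the divided power algebra. -/
def forms (K : Type*) [Field K] (σ : Type*) (e : ℕ) : Submodule K (DP K σ) :=
  Finsupp.supported K K {a | a.degree = e}

/-- Contraction by the monomial `x^a`: the coefficient of `X^[c]` in `x^a ∘ F` is the coefficient
of `X^[c + a]` in `F`. -/
def contractMonomial (a : σ →₀ ℕ) : DP K σ →ₗ[K] DP K σ :=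
  Finsupp.lcomapDomain (fun c => c + a) (add_left_injective a)

/-- The contraction action `f ∘ F` of a polynomial `f` in the variables `x_s` on the divided power
algebra. -/
def contract : MvPolynomial σ K →ₗ[K] DP K σ →ₗ[K] DP K σ :=
  (MvPolynomial.basisMonomials σ K).constr K contractMonomial

theorem contractMonomial_apply (a c : σ →₀ ℕ) (F : DP K σ) :
    contractMonomial a F c = F (c + a) := rfl

theorem contract_monomial (a : σ →₀ ℕ) (r : K) :
    contract (MvPolynomial.monomial a r) = r • (contractMonomial a : DP K σ →ₗ[K] DP K σ) := by
  have h : MvPolynomial.monomial a r = r • MvPolynomial.basisMonomials σ K a := by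
    simp [MvPolynomial.smul_monomial]
  rw [h, map_smul, contract, Basis.constr_basis]

/-- The usual formula for the contraction action of a variable on a monomial. -/
theorem contract_X_single (s : σ) (c : σ →₀ ℕ) :
    contract (MvPolynomial.X s) (Finsupp.single c (1 : K)) =
      if 0 < c s then Finsupp.single (c - Finsupp.single s 1) 1 else 0 := by
  classical
  rw [MvPolynomial.X, contract_monomial, one_smul]
  ext e
  rw [contractMonomial_apply]
  split_ifs with h
  · have hle : Finsupp.single s 1 ≤ c := by
      rw [Finsupp.single_le_iff]; exact h
    rw [Finsupp.single_apply, Finsupp.single_apply]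
    congr 1
    rw [eq_iff_iff]
    constructor
    · rintro rfl; simp
    · rintro rfl; rw [tsub_add_cancel_of_le hle]
  · rw [Finsupp.single_apply, if_neg, Finsupp.zero_apply]
    rintro rfl
    simp at h

theorem contract_mul (f g : MvPolynomial σ K) (F : DP K σ) :
    contract (f * g) F = contract f (contract g F) := by
  induction f using MvPolynomial.induction_on' with
  | add p q hp hq => rw [add_mul, map_add, LinearMap.add_apply, hp, hq, map_add, LinearMap.add_apply]
  | monomial a r =>
    induction g using MvPolynomial.induction_on' with
    | add p q hp hq =>
      rw [mul_add, map_add, LinearMap.add_apply, hp, hq, map_add, LinearMap.add_apply, map_add]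
    | monomial b t =>
      rw [MvPolynomial.monomial_mul, contract_monomial, contract_monomial, contract_monomial]
      ext c
      simp [contractMonomial_apply, mul_assoc, mul_left_comm, add_assoc]

/-- The annihilator `Ann_R F = {f ∈ R | f ∘ F = 0}`. -/
def annIdeal (F : DP K σ) : Ideal (MvPolynomial σ K) where
  carrier := {f | contract f F = 0}
  add_mem' := by
    intro f g hf hg
    simp only [Set.mem_ofPred_eq] at hf hg ⊢
    rw [map_add, LinearMap.add_apply, hf, hg, add_zero]
  zero_mem' := by simp
  smul_mem' := by
    intro f g hg
    simp only [Set.mem_ofPred_eq] at hg ⊢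
    rw [smul_eq_mul, contract_mul, hg, map_zero]

/-- The algebra `A_F = R / Ann_R F` with Macaulay dual generator `F`. -/
abbrev Alg (F : DP K σ) := MvPolynomial σ K ⧸ annIdeal F

/-- The space `[A_F]_1` of linear forms. -/
def linearForms (F : DP K σ) : Submodule K (Alg F) :=
  (MvPolynomial.homogeneousSubmodule σ K 1).map (Ideal.Quotient.mkₐ K (annIdeal F)).toLinearMap

/-! ## Jordan types -/

/-- `P` is the Jordan type of the nilpotent endomorphism `T` of the finite-dimensional space `V`:
there is a Jordan basis `T^i z_k`, `0 ≤ i < p_k`, with `T^(p_k) z_k = 0`, whose string lengths `p_k`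
are the parts of `P`. -/
def IsJordanType {V : Type*} [AddCommGroup V] [Module K V] (T : Module.End K V)
    (P : Nat.Partition (finrank K V)) : Prop :=
  ∃ (s : ℕ) (p : Fin s → ℕ) (z : Fin s → V) (b : Basis (Σ k : Fin s, Fin (p k)) K V),
    (∀ k i, b ⟨k, i⟩ = (T ^ (i : ℕ)) (z k)) ∧
    (∀ k, (T ^ (p k)) (z k) = 0) ∧
    P.parts = Finset.univ.val.map p

/-- The dominance order: with the parts of `P` and `Q` in decreasing order, each partial sum
of `P` is at least the corresponding partial sum of `Q`. -/
def Dominates {N : ℕ} (P Q : Nat.Partition N) : Prop :=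
  ∀ k ≤ min P.parts.card Q.parts.card,
    ((Q.parts.sort (· ≥ ·)).take k).sum ≤ ((P.parts.sort (· ≥ ·)).take k).sum

/-- `P` is the generic linear Jordan type of `A_F`: it is the Jordan type of (multiplication by)
some linear form, and it dominates the Jordan type of every linear form. -/
def IsGenericLinearJordanType (F : DP K σ) (P : Nat.Partition (finrank K (Alg F))) : Prop :=
  (∃ ℓ ∈ linearForms F, IsJordanType (LinearMap.mulLeft K ℓ) P) ∧
  ∀ ℓ ∈ linearForms F, ∀ Q : Nat.Partition (finrank K (Alg F)),
    IsJordanType (LinearMap.mulLeft K ℓ) Q → Dominates P Q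

/-! ## Full Perazzo forms -/

/-- The variable `X_i` of `K_DP[X_0, …, X_n, Y_1, …, Y_m]`. -/
def varX {n m : ℕ} (i : Fin (n + 1)) : DP K (Fin (n + 1) ⊕ Fin m) :=
  Finsupp.single (Finsupp.single (Sum.inl i) 1) 1

/-- The inclusion of `K_DP[Y_1, …, Y_m]` into `K_DP[X_0, …, X_n, Y_1, …, Y_m]`. -/
def inclY {n m : ℕ} : DP K (Fin m) →ₗ[K] DP K (Fin (n + 1) ⊕ Fin m) :=
  Finsupp.lmapDomain K K (Finsupp.mapDomain Sum.inr)

/-- `F = X_0 P_0 + ⋯ + X_n P_n + G`, where `P_0, …, P_n` is a basis of the space of forms of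
degree `d - 1` in the `Y`-variables and `G` is a form of degree `d` in the `Y`-variables.
(For `m ≥ 2` and `d ≥ 3` there are more than `m` forms `P_i`, so that these are automatically
algebraically dependent polynomials, as the definition of a Perazzo form demands.) -/
def IsFullPerazzoForm {n m : ℕ} (d : ℕ) (F : DP K (Fin (n + 1) ⊕ Fin m)) : Prop :=
  ∃ (P : Fin (n + 1) → DP K (Fin m)) (G : DP K (Fin m)),
    LinearIndependent K P ∧
    Submodule.span K (Set.range P) = forms K (Fin m) (d - 1) ∧
    G ∈ forms K (Fin m) d ∧
    F = ∑ i, dpMul (varX i) (inclY (P i)) + inclY G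

end Perazzo

end

noncomputable section

namespace Perazzo

open Module

/-! ## Jordan types of nilpotent endomorphisms -/

section Jordan

variable {K V : Type*} [Field K] [AddCommGroup V] [Module K V]

/-! The map g ↦ g∘F identifies A_F with R∘F, and multiplication by ℓ becomes contraction by ℓ
(`algEmb`, `finrank_range_mulLeft_mk`). Write d = e + 2 and let N_k be the number of Y-monomials of
degree at most k. Since x_i∘F = P_i and the P_i span all Y-forms of degree e + 1, the space R∘F is
the direct sum of the t∘F, with t a polynomial in the y's of degree at most e + 1, and of all
elements of degree at most e + 1 in the Y's (`range_contract_eq`, `paramMap_one_injective`). Hence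
dim A_F = 2 N_{e+1}.

For every ℓ the image of contraction by ℓ lies in the sum of the ℓt∘F with deg t ≤ e and of the
Y-elements of degree at most e, so its rank is at most 2 N_e (`map_contract_range_le`); each y_j
attains this bound (`le_finrank_map_contract_X_inr_range`). The smallest corank is therefore
2(N_{e+1} - N_e) = 2(n + 1), and the corank counts the Jordan blocks.

The generic type exists because dominance can be read from ranks of powers: rank T^j is the sum of
the truncated differences p_k - j, and the r-th partial sum of the parts is the minimum over j of rj
+ rank T^j (`dominates_of_sum_tsub_le`). Over an infinite field a single ℓ maximises all these ranks
at once (`exists_forall_finrank_range_pow_le`). -/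

/-- A Jordan basis determines the ranks of the powers. -/
theorem IsJordanType.finrank_range_pow {T : Module.End K V} {P : Nat.Partition (finrank K V)}
    (h : IsJordanType T P) (j : ℕ) :
    finrank K (LinearMap.range (T ^ j)) = (P.parts.map (· - j)).sum := by
  classical
  obtain ⟨s, p, z, b, hb, hz, hP⟩ := h
  have hz' : ∀ k i, p k ≤ i → (T ^ i) (z k) = 0 := fun k i hi => by
    rw [← Nat.sub_add_cancel hi, pow_add, Module.End.mul_apply, hz, map_zero]
  have hlt : ∀ (k : Fin s) (i : Fin (p k - j)), (i : ℕ) + j < p k := fun k i => by omega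
  -- T^j moves each string j places along, so its range is spanned by the basis vectors in position
  -- at least j; truncated subtraction empties the strings shorter than j.
  let e : (Σ k : Fin s, Fin (p k - j)) → (Σ k : Fin s, Fin (p k)) :=
    fun x => ⟨x.1, ⟨x.2 + j, hlt x.1 x.2⟩⟩
  have he : Function.Injective e := by
    rintro ⟨k, i⟩ ⟨k', i'⟩ h
    simp only [e, Sigma.mk.injEq] at h
    obtain ⟨rfl, h⟩ := h
    simp only [heq_eq_eq, Fin.mk.injEq, add_left_inj] at h
    rw [Fin.ext h]
  have hrange : LinearMap.range (T ^ j) = Submodule.span K (Set.range (b ∘ e)) := by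
    rw [LinearMap.range_eq_map, ← b.span_eq, Submodule.map_span]
    apply le_antisymm <;> rw [Submodule.span_le]
    · rintro _ ⟨_, ⟨⟨k, i⟩, rfl⟩, rfl⟩
      rw [hb, ← Module.End.mul_apply, ← pow_add]
      by_cases hi : j + (i : ℕ) < p k
      · exact Submodule.subset_span ⟨⟨k, ⟨i, by omega⟩⟩, by
          simp only [e, Function.comp, hb, add_comm]⟩
      · rw [hz' k _ (by omega)]
        exact Submodule.zero_mem _
    · rintro _ ⟨⟨k, i⟩, rfl⟩
      refine Submodule.subset_span ⟨_, ⟨⟨k, ⟨i, by omega⟩⟩, rfl⟩, ?_⟩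
      simp only [e, Function.comp, hb]
      rw [← Module.End.mul_apply, ← pow_add, add_comm]
  rw [hrange, finrank_span_eq_card (b.linearIndependent.comp e he), hP]
  simp only [Fintype.card_sigma, Fintype.card_fin, Multiset.map_map, Finset.sum]
  rfl

theorem sum_map_tsub_one_add_card (s : Multiset ℕ) (hs : ∀ x ∈ s, 0 < x) :
    (s.map (· - 1)).sum + s.card = s.sum := by
  induction s using Multiset.induction_on with
  | empty => simp
  | cons a s ih =>
    have := hs a (Multiset.mem_cons_self a s)
    have := ih fun x hx => hs x (Multiset.mem_cons_of_mem hx)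
    simp only [Multiset.map_cons, Multiset.sum_cons, Multiset.card_cons]
    omega

/-- The number of parts of the Jordan type is the corank. -/
theorem IsJordanType.finrank_range_add_card {T : Module.End K V}
    {P : Nat.Partition (finrank K V)} (h : IsJordanType T P) :
    finrank K (LinearMap.range T) + P.parts.card = finrank K V := by
  have := h.finrank_range_pow 1
  rw [pow_one] at this
  rw [this, sum_map_tsub_one_add_card _ fun x hx => P.parts_pos hx, P.parts_sum]

open Polynomial in
/-- A nilpotent endomorphism has a Jordan basis, possibly with some empty strings. -/
theorem exists_jordan_basis [FiniteDimensional K V] (T : Module.End K V) (hT : IsNilpotent T) :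
    ∃ (s : ℕ) (p : Fin s → ℕ) (z : Fin s → V) (b : Basis (Σ k : Fin s, Fin (p k)) K V),
      (∀ k i, b ⟨k, i⟩ = (T ^ (i : ℕ)) (z k)) ∧ ∀ k, (T ^ (p k)) (z k) = 0 := by
  classical
  obtain ⟨N, hN⟩ := hT
  -- With X acting as T, V is an X-power torsion K[X]-module, hence a direct sum of modules
  -- K[X]/(X^(p i)); the classes of 1 generate the strings.
  have htors : Module.IsTorsion' (AEval' T) (Submonoid.powers (X : K[X])) := by
    intro x
    refine ⟨⟨X ^ N, N, rfl⟩, ?_⟩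
    obtain ⟨x, rfl⟩ := (AEval'.of T).surjective x
    change (X ^ N : K[X]) • (AEval'.of T) x = 0
    rw [AEval'.X_pow_smul_of, hN, zero_smul, map_zero]
  obtain ⟨s, p, ⟨f⟩⟩ := Module.torsion_by_prime_power_decomposition
    (Polynomial.irreducible_X (R := K)) htors
  let B : ∀ i, Basis (Fin (p i)) K (K[X] ⧸ Submodule.span K[X] {(X : K[X]) ^ p i}) := fun i =>
    (AdjoinRoot.powerBasisAux' (monic_X_pow (R := K) (p i))).reindex
      (finCongr (natDegree_X_pow (p i)))
  have hB : ∀ i j, B i j = (X : K[X]) ^ (j : ℕ) • (Submodule.Quotient.mk (1 : K[X])) := by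
    intro i j
    refine (Basis.reindex_apply (AdjoinRoot.powerBasisAux' (monic_X_pow (R := K) (p i)))
      (finCongr (natDegree_X_pow (p i))) j).trans ?_
    refine ((AdjoinRoot.powerBasis' (monic_X_pow (R := K) (p i))).basis_eq_pow
      ((finCongr (natDegree_X_pow (p i))).symm j)).trans ?_
    rw [← Submodule.Quotient.mk_smul, smul_eq_mul, mul_one]
    rfl
  let c : Basis (Σ k : Fin s, Fin (p k)) K (DirectSum (Fin s) fun i =>
      K[X] ⧸ Submodule.span K[X] {(X : K[X]) ^ p i}) := DFinsupp.basis B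
  let g : V ≃ₗ[K] (DirectSum (Fin s) fun i => K[X] ⧸ Submodule.span K[X] {(X : K[X]) ^ p i}) :=
    (AEval'.of T).trans (f.restrictScalars K)
  have hg : ∀ (n : ℕ) v, g ((T ^ n) v) = (X : K[X]) ^ n • g v := by
    intro n v
    change f (AEval'.of T _) = X ^ n • f (AEval'.of T v)
    rw [← map_smul, AEval'.X_pow_smul_of]
    rfl
  refine ⟨s, p, fun k => g.symm (DirectSum.lof K[X] _ _ k (Submodule.Quotient.mk 1)),
    c.map g.symm, fun k i => ?_, fun k => ?_⟩
  · apply g.injective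
    rw [hg, Basis.map_apply, LinearEquiv.apply_symm_apply, LinearEquiv.apply_symm_apply, ← map_smul,
      ← hB]
    rw [Basis.apply_eq_iff]
    change (sigmaFinsuppLequivDFinsupp K).symm (DFinsupp.mapRange.linearEquiv
      (fun i => (B i).repr) (DFinsupp.single k (B k i))) = _
    rw [LinearEquiv.symm_apply_eq]
    simp
  · apply g.injective
    rw [hg, LinearEquiv.apply_symm_apply, ← map_smul, ← Submodule.Quotient.mk_smul, smul_eq_mul,
      mul_one, (Submodule.Quotient.mk_eq_zero _).2 (Submodule.mem_span_singleton_self _), map_zero,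
      map_zero]

/-- A nilpotent endomorphism of a finite-dimensional space has a Jordan type. -/
theorem exists_isJordanType [FiniteDimensional K V] (T : Module.End K V) (hT : IsNilpotent T) :
    ∃ P, IsJordanType T P := by
  classical
  obtain ⟨s, p, z, b, hb, hz⟩ := exists_jordan_basis T hT
  -- Empty strings contribute no basis vector and are dropped, since the parts of a partition are
  -- positive.
  let e := (Fintype.equivFin {k // 0 < p k}).symm
  let u : (Σ k, Fin (p (e k))) → (Σ k, Fin (p k)) := fun x => ⟨e x.1, x.2⟩
  have hu : Function.Bijective u := by
    constructor
    · rintro ⟨k, i⟩ ⟨k', i'⟩ h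
      simp only [u, Sigma.mk.injEq] at h
      obtain ⟨h1, h2⟩ := h
      obtain rfl := e.injective (Subtype.ext h1)
      rw [heq_eq_eq] at h2
      rw [h2]
    · rintro ⟨k, i⟩
      obtain ⟨k', hk'⟩ := e.surjective ⟨k, i.pos⟩
      obtain rfl : (e k' : Fin s) = k := by rw [hk']
      exact ⟨⟨k', i⟩, rfl⟩
  let b' := b.reindex (Equiv.ofBijective u hu).symm
  refine ⟨⟨Finset.univ.val.map fun k => p (e k), ?_, ?_⟩, _, fun k => p (e k), fun k => z (e k), b',
    ?_, fun k => hz _, rfl⟩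
  · intro i hi
    obtain ⟨k, -, rfl⟩ := Multiset.mem_map.1 hi
    exact (e k).2
  · rw [finrank_eq_card_basis b']
    simp [Fintype.card_sigma, Finset.sum]
  · intro k i
    rw [Basis.reindex_apply]
    exact hb _ _

end Jordan

/-! ## Dominance -/

/-- Each of the at most r entries taken satisfies x ≤ j + (x - j), and the remaining truncated
differences only add. -/
theorem sum_le_mul_add_sum_tsub (l : List ℕ) (j r : ℕ) :
    (l.take r).sum ≤ r * j + (l.map (· - j)).sum := by
  induction l generalizing r with
  | nil => simp
  | cons a l ih =>
    cases r with
    | zero => simp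
    | succ r =>
      have := ih r
      simp only [List.take_succ_cons, List.sum_cons, List.map_cons, add_mul, one_mul]
      omega

/-- The bound of `sum_le_mul_add_sum_tsub` is attained at j = l[r], the first entry left out:
entries before it are at least j, those after it at most j. If nothing is left out, j = 0 works. -/
theorem exists_sum_take_eq (l : List ℕ) (hl : l.Pairwise (· ≥ ·)) (r : ℕ) (hr : r ≤ l.length) :
    ∃ j, (l.take r).sum = r * j + (l.map (· - j)).sum := by
  have key : ∀ j, (∀ x ∈ l.take r, j ≤ x) → (∀ x ∈ l.drop r, x ≤ j) →
      (l.take r).sum = r * j + (l.map (· - j)).sum := by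
    intro j h1 h2
    conv_rhs => rw [← List.take_append_drop r l]
    rw [List.map_append, List.sum_append,
      List.sum_eq_zero (l := (l.drop r).map (· - j)) (by
        intro x hx
        obtain ⟨y, hy, rfl⟩ := List.mem_map.1 hx
        exact Nat.sub_eq_zero_of_le (h2 y hy)), add_zero]
    have h3 : (l.take r).length = r := List.length_take_of_le hr
    generalize l.take r = t at h1 h3
    clear hr hl h2
    subst h3
    induction t with
    | nil => simp
    | cons a t ih =>
      have := ih fun x hx => h1 x (List.mem_cons_of_mem a hx)
      have := h1 a List.mem_cons_self
      simp only [List.sum_cons, List.map_cons, List.length_cons, add_mul, one_mul]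
      omega
  rcases hr.lt_or_eq with hlt | rfl
  · refine ⟨l[r], key _ ?_ ?_⟩
    · rw [← List.take_append_drop r l, List.pairwise_append] at hl
      intro x hx
      refine hl.2.2 x hx _ ?_
      rw [List.drop_eq_getElem_cons hlt]
      exact List.mem_cons_self
    · have h := hl.drop (i := r)
      rw [List.drop_eq_getElem_cons hlt] at h ⊢
      intro x hx
      rcases List.mem_cons.1 hx with rfl | hx
      · exact le_rfl
      · exact (List.pairwise_cons.1 h).1 x hx
  · exact ⟨0, key 0 (fun _ _ => Nat.zero_le _) (by simp)⟩

/-- The j that is optimal for the r-th partial sum of P still gives an upper bound for that of Q. -/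
theorem dominates_of_sum_tsub_le {N : ℕ} {P Q : Nat.Partition N}
    (h : ∀ j, (Q.parts.map (· - j)).sum ≤ (P.parts.map (· - j)).sum) : Dominates P Q := by
  intro r hr
  have key : ∀ (A : Multiset ℕ) j,
      ((A.sort (· ≥ ·)).map (· - j)).sum = (A.map (· - j)).sum := by
    intro A j
    conv_rhs => rw [← Multiset.sort_eq A (· ≥ ·), Multiset.map_coe, Multiset.sum_coe]
  obtain ⟨j, hj⟩ := exists_sum_take_eq (P.parts.sort (· ≥ ·)) (Multiset.pairwise_sort _ _) r
    (by rw [Multiset.length_sort]; omega)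
  rw [hj, key]
  refine (sum_le_mul_add_sum_tsub _ j r).trans ?_
  rw [key]
  exact Nat.add_le_add_left (h j) _

/-- If Q had more parts, its first `P.parts.card` parts would already sum to N, leaving zero for the
others, which are positive. -/
theorem card_le_of_dominates {N : ℕ} {P Q : Nat.Partition N} (h : Dominates Q P) :
    Q.parts.card ≤ P.parts.card := by
  by_contra! hlt
  have h1 := h _ (le_min hlt.le le_rfl)
  rw [List.take_of_length_le (by rw [Multiset.length_sort])] at h1
  have hs : ∀ A : Multiset ℕ, (A.sort (· ≥ ·)).sum = A.sum := fun A => by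
    conv_rhs => rw [← Multiset.sort_eq A (· ≥ ·), Multiset.sum_coe]
  have h2 := congrArg List.sum (List.take_append_drop P.parts.card (Q.parts.sort (· ≥ ·)))
  rw [hs, P.parts_sum] at h1
  rw [List.sum_append, hs, Q.parts_sum] at h2
  have h3 : ((Q.parts.sort (· ≥ ·)).drop P.parts.card).sum = 0 := by omega
  rw [List.sum_eq_zero_iff] at h3
  have hlen : 0 < ((Q.parts.sort (· ≥ ·)).drop P.parts.card).length := by
    rw [List.length_drop, Multiset.length_sort]; omega
  have hmem := List.getElem_mem hlen
  have := Q.parts_pos ((Multiset.mem_sort _).1 (List.mem_of_mem_drop hmem))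
  rw [h3 _ hmem] at this
  exact lt_irrefl _ this

theorem eq_of_dominates {N : ℕ} {P Q : Nat.Partition N} (h : Dominates P Q) (h' : Dominates Q P) :
    P = Q := by
  have hc : P.parts.card = Q.parts.card :=
    le_antisymm (card_le_of_dominates h) (card_le_of_dominates h')
  have hl : P.parts.sort (· ≥ ·) = Q.parts.sort (· ≥ ·) := by
    have hlen : (P.parts.sort (· ≥ ·)).length = (Q.parts.sort (· ≥ ·)).length := by
      simpa using hc
    have hsum : ∀ k ≤ P.parts.card,
        ((P.parts.sort (· ≥ ·)).take k).sum = ((Q.parts.sort (· ≥ ·)).take k).sum := fun k hk =>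
      le_antisymm (h' k (le_min (hc ▸ hk) hk)) (h k (le_min hk (hc ▸ hk)))
    refine List.ext_getElem hlen fun i h1 h2 => ?_
    have h3 := hsum (i + 1) (by rw [Multiset.length_sort] at h1; omega)
    have h4 := hsum i (by rw [Multiset.length_sort] at h1; omega)
    rw [List.sum_take_succ _ _ h1, List.sum_take_succ _ _ h2] at h3
    omega
  ext1
  rw [← Multiset.sort_eq P.parts (· ≥ ·), hl, Multiset.sort_eq]

end Perazzo

namespace Perazzo

open Module

/-! ## Generic ranks -/

theorem exists_forall_le_of_le {α : Type*} [Nonempty α] (f : α → ℕ) (N : ℕ) (h : ∀ a, f a ≤ N) :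
    ∃ a, ∀ a', f a' ≤ f a := by
  refine ⟨Function.argmin (fun a => N - f a), fun a' => ?_⟩
  have h1 := Function.argmin_le (fun a => N - f a) a'
  have h2 := h a'
  have h3 := h (Function.argmin (fun a => N - f a))
  omega

/-- W is a section of A over its range and U a retraction onto that range, both in coordinates. Then
det(UAW) plays the role of a nonvanishing maximal minor, with no choice of rows and columns. -/
theorem _root_.Matrix.exists_mul_mul_eq_one {K n : Type*} [Field K] [Fintype n] [DecidableEq n]
    (A : Matrix n n K) :
    ∃ (U : Matrix (Fin A.rank) n K) (W : Matrix n (Fin A.rank) K), U * A * W = 1 := by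
  let f := A.mulVecLin
  obtain ⟨g, hg⟩ := f.rangeRestrict.exists_rightInverse_of_surjective f.range_rangeRestrict
  obtain ⟨h, hh⟩ := (LinearMap.range f).subtype.exists_leftInverse_of_injective
    (Submodule.ker_subtype _)
  let e : LinearMap.range f ≃ₗ[K] (Fin A.rank → K) := (finBasis K (LinearMap.range f)).equivFun
  refine ⟨LinearMap.toMatrix' (e.toLinearMap ∘ₗ h), LinearMap.toMatrix' (g ∘ₗ e.symm.toLinearMap),
    ?_⟩
  have hA : A = LinearMap.toMatrix' f := (LinearMap.toMatrix'_toLin' A).symm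
  conv_lhs => enter [1, 2]; rw [hA]
  rw [← LinearMap.toMatrix'_comp, ← LinearMap.toMatrix'_comp, ← LinearMap.toMatrix'_id]
  congr 1
  ext1 i
  ext1
  have h1 : ∀ y, f (g y) = y := fun y => congrArg Subtype.val (LinearMap.congr_fun hg y)
  have h2 : ∀ y : LinearMap.range f, h y = y := fun y => LinearMap.congr_fun hh y
  simp [h1, h2]

theorem _root_.Matrix.le_rank_of_det_ne_zero {K n : Type*} [Field K] [Fintype n] [DecidableEq n]
    {r : ℕ} (A : Matrix n n K) (U : Matrix (Fin r) n K) (W : Matrix n (Fin r) K)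
    (h : (U * A * W).det ≠ 0) : r ≤ A.rank := by
  have h1 := Matrix.rank_of_isUnit _ ((Matrix.isUnit_iff_isUnit_det _).2 (isUnit_iff_ne_zero.2 h))
  rw [Fintype.card_fin] at h1
  calc r = (U * A * W).rank := h1.symm
    _ ≤ (U * A).rank := Matrix.rank_mul_le_left _ _
    _ ≤ A.rank := Matrix.rank_mul_le_right _ _

/-- Over an infinite field, a linear family of endomorphisms has a member all of whose powers (up to
any given bound) have the largest possible rank. -/
theorem exists_forall_finrank_range_pow_le {K V σ : Type*} [Field K] [Infinite K] [AddCommGroup V]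
    [Module K V] [FiniteDimensional K V] [Fintype σ] (T : (σ → K) →ₗ[K] Module.End K V) (n : ℕ) :
    ∃ a, ∀ k < n, ∀ a', finrank K (LinearMap.range (T a' ^ k)) ≤
      finrank K (LinearMap.range (T a ^ k)) := by
  classical
  let b := finBasis K V
  let mat : Module.End K V ≃ₐ[K] Matrix _ _ K := LinearMap.toMatrixAlgEquiv b
  have hrank : ∀ f, finrank K (LinearMap.range f) = (mat f).rank := fun f =>
    (Matrix.rank_eq_finrank_range_toLin (mat f) b b).symm ▸ by
      rw [show Matrix.toLin b b (mat f) = f from Matrix.toLin_toMatrix b b f]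
  -- The generic member of the family: its entries are linear forms in the parameters, and
  -- evaluating at a gives the matrix of `T a`.
  let M : Matrix _ _ (MvPolynomial σ K) :=
    ∑ s, (MvPolynomial.X s : MvPolynomial σ K) • (mat (T (Pi.single s 1))).map MvPolynomial.C
  have hM : ∀ a, M.map (MvPolynomial.eval a) = mat (T a) := by
    intro a
    have : a = ∑ s, a s • Pi.single s (1 : K) := by
      ext s
      simp [Finset.sum_apply, Pi.single_apply]
    conv_rhs => rw [this]
    rw [map_sum, map_sum]
    ext i j
    simp [M, Matrix.sum_apply]
  have hMk : ∀ a k, (M ^ k).map (MvPolynomial.eval a) = mat (T a ^ k) := by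
    intro a k
    have := (RingHom.mapMatrix (m := Fin (finrank K V)) (MvPolynomial.eval a)).map_pow M k
    rw [RingHom.mapMatrix_apply, RingHom.mapMatrix_apply, hM] at this
    rw [this, map_pow]
  choose a₀ ha₀ using fun k => exists_forall_le_of_le
    (fun a => finrank K (LinearMap.range (T a ^ k))) (finrank K V)
    (fun a => Submodule.finrank_le _)
  choose U W hUW using fun k => (mat (T (a₀ k) ^ k)).exists_mul_mul_eq_one
  -- A minor of M^k that equals 1 at the rank-maximising point `a₀ k`; wherever it is nonzero the
  -- k-th power has maximal rank. A nonzero of the product over k < n serves all these powers.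
  let p : ℕ → MvPolynomial σ K := fun k =>
    Matrix.det (Matrix.map (U k) (MvPolynomial.C (σ := σ)) * M ^ k *
      Matrix.map (W k) (MvPolynomial.C (σ := σ)))
  have hp : ∀ k a, MvPolynomial.eval a (p k) = (U k * mat (T a ^ k) * W k).det := by
    intro k a
    rw [RingHom.map_det, RingHom.mapMatrix_apply, Matrix.map_mul, Matrix.map_mul, hMk,
      Matrix.map_map, Matrix.map_map]
    congr <;> ext <;> simp
  have hp0 : ∀ k, p k ≠ 0 := by
    intro k h
    have := hp k (a₀ k)
    rw [hUW, h] at this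
    simp at this
  have hprod : ∏ k ∈ Finset.range n, p k ≠ 0 := Finset.prod_ne_zero_iff.2 fun k _ => hp0 k
  obtain ⟨a, ha⟩ : ∃ a, MvPolynomial.eval a (∏ k ∈ Finset.range n, p k) ≠ 0 := by
    by_contra! h
    exact hprod (MvPolynomial.funext fun a => by rw [h, map_zero])
  rw [map_prod, Finset.prod_ne_zero_iff] at ha
  refine ⟨a, fun k hk a' => (ha₀ k a').trans ?_⟩
  have h1 := ha k (Finset.mem_range.2 hk)
  rw [hp] at h1
  rw [hrank, hrank]
  exact Matrix.le_rank_of_det_ne_zero _ _ _ h1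

end Perazzo

namespace Perazzo

open Module MvPolynomial

/-! ## The contraction action -/

section Contract

variable {K σ ι τ : Type*} [Field K]

theorem contract_apply (f : MvPolynomial σ K) (F : DP K σ) (c : σ →₀ ℕ) :
    contract f F c = ∑ a ∈ f.support, coeff a f * F (c + a) := by
  conv_lhs => rw [f.as_sum]
  rw [map_sum, LinearMap.sum_apply, Finsupp.finsetSum_apply]
  exact Finset.sum_congr rfl fun a _ => by
    rw [contract_monomial, LinearMap.smul_apply, Finsupp.smul_apply, contractMonomial_apply,
      smul_eq_mul]

theorem contract_X_apply (s : σ) (F : DP K σ) (c : σ →₀ ℕ) :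
    contract (X s) F c = F (c + Finsupp.single s 1) := by
  rw [X, contract_monomial, one_smul, contractMonomial_apply]

theorem contract_C (r : K) (F : DP K σ) : contract (C r) F = r • F := by
  ext c
  rw [C_apply, contract_monomial, LinearMap.smul_apply, Finsupp.smul_apply, contractMonomial_apply,
    add_zero, Finsupp.smul_apply]

/-! ### Degree filtration -/

/-- The elements of degree at most `e` in the divided power algebra. -/
def formsLE (K : Type*) [Field K] (σ : Type*) (e : ℕ) : Submodule K (DP K σ) :=
  Finsupp.supported K K {a | a.degree ≤ e}

theorem mem_formsLE {e : ℕ} {s : DP K σ} : s ∈ formsLE K σ e ↔ ∀ c, s c ≠ 0 → c.degree ≤ e := by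
  rw [formsLE, Finsupp.mem_supported]
  exact ⟨fun h c hc => h (Finsupp.mem_support_iff.2 hc),
    fun h c hc => h c (Finsupp.mem_support_iff.1 hc)⟩

theorem forms_le_formsLE (e : ℕ) : forms K σ e ≤ formsLE K σ e :=
  Finsupp.supported_mono fun _ h => le_of_eq h

theorem formsLE_mono {e e' : ℕ} (h : e ≤ e') : formsLE K σ e ≤ formsLE K σ e' :=
  Finsupp.supported_mono fun _ h' => le_trans h' h

/-- A polynomial of order at least `k` lowers degrees by at least `k`. -/
theorem degree_add_le_of_contract_ne_zero {k e : ℕ} {t : MvPolynomial σ K} {s : DP K σ}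
    (ht : ∀ a ∈ t.support, k ≤ a.degree) (hs : s ∈ formsLE K σ e) {c : σ →₀ ℕ}
    (hc : contract t s c ≠ 0) : c.degree + k ≤ e := by
  rw [contract_apply] at hc
  obtain ⟨a, ha, h⟩ := Finset.exists_ne_zero_of_sum_ne_zero hc
  have h1 := mem_formsLE.1 hs _ (right_ne_zero_of_mul h)
  rw [map_add] at h1
  have := ht a ha
  omega

theorem contract_mem_formsLE {k e e' : ℕ} {t : MvPolynomial σ K} {s : DP K σ}
    (ht : ∀ a ∈ t.support, k ≤ a.degree) (hs : s ∈ formsLE K σ e) (h : e ≤ e' + k) :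
    contract t s ∈ formsLE K σ e' :=
  mem_formsLE.2 fun c hc => by
    have := degree_add_le_of_contract_ne_zero ht hs hc
    omega

theorem contract_eq_zero_of_lt {k e : ℕ} {t : MvPolynomial σ K} {s : DP K σ}
    (ht : ∀ a ∈ t.support, k ≤ a.degree) (hs : s ∈ formsLE K σ e) (h : e < k) :
    contract t s = 0 := by
  ext c
  by_contra hc
  have := degree_add_le_of_contract_ne_zero ht hs hc
  omega

theorem le_degree_of_mem_support_X [DecidableEq σ] (j : σ) :
    ∀ a ∈ (X j : MvPolynomial σ K).support, 1 ≤ a.degree := by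
  intro a ha
  rw [support_X, Finset.mem_singleton] at ha
  rw [ha, Finsupp.degree_single]

/-- Splitting a polynomial into its parts of degree `≤ e` and `> e`. -/
theorem exists_add_restrictTotalDegree (t : MvPolynomial σ K) (e : ℕ) :
    ∃ t₁ ∈ restrictTotalDegree σ K e, ∃ t₂ : MvPolynomial σ K,
      (∀ a ∈ t₂.support, e + 1 ≤ a.degree) ∧ t = t₁ + t₂ := by
  have hc : ∀ a, coeff a (∑ i ∈ Finset.range (e + 1), homogeneousComponent i t) =
      if a.degree ≤ e then coeff a t else 0 := by
    intro a
    simp_rw [coeff_sum, coeff_homogeneousComponent]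
    rw [Finset.sum_ite_eq]
    simp
  refine ⟨∑ i ∈ Finset.range (e + 1), homogeneousComponent i t, ?_,
    t - ∑ i ∈ Finset.range (e + 1), homogeneousComponent i t, ?_, by ring⟩
  · intro a ha
    by_contra h
    exact MvPolynomial.mem_support_iff.1 ha ((hc a).trans (if_neg h))
  · intro a ha
    rw [MvPolynomial.mem_support_iff, coeff_sub, hc] at ha
    by_contra h
    exact ha (by rw [if_pos (by omega), sub_self])

/-! ### Separating the X- and Y-variables -/

/-- The inclusion `s ↦ X^[x] s` of the divided power algebra in the second set of variables. -/
def emb (K : Type*) [Field K] {ι τ : Type*} (x : ι →₀ ℕ) : DP K τ →ₗ[K] DP K (ι ⊕ τ) :=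
  Finsupp.lmapDomain K K fun b => Finsupp.sumElim x b

/-- The first component of an exponent. -/
def fstExp (c : ι ⊕ τ →₀ ℕ) : ι →₀ ℕ := (Finsupp.sumFinsuppEquivProdFinsupp c).1

/-- The second component of an exponent. -/
def sndExp (c : ι ⊕ τ →₀ ℕ) : τ →₀ ℕ := (Finsupp.sumFinsuppEquivProdFinsupp c).2

@[simp] theorem fstExp_apply (c : ι ⊕ τ →₀ ℕ) (i : ι) : fstExp c i = c (Sum.inl i) := rfl

@[simp] theorem sndExp_apply (c : ι ⊕ τ →₀ ℕ) (j : τ) : sndExp c j = c (Sum.inr j) := rfl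

theorem sumElim_fstExp_sndExp (c : ι ⊕ τ →₀ ℕ) : Finsupp.sumElim (fstExp c) (sndExp c) = c := by
  ext (i | j) <;> simp

theorem sumElim_injective (x : ι →₀ ℕ) :
    Function.Injective fun b : τ →₀ ℕ => Finsupp.sumElim x b := by
  intro b b' h
  ext j
  simpa using DFunLike.congr_fun h (Sum.inr j)

theorem emb_apply_sumElim (x : ι →₀ ℕ) (s : DP K τ) (b : τ →₀ ℕ) :
    emb K x s (Finsupp.sumElim x b) = s b :=
  Finsupp.mapDomain_apply (sumElim_injective x) s b

theorem emb_apply_of_ne (x : ι →₀ ℕ) (s : DP K τ) (c : ι ⊕ τ →₀ ℕ) (h : fstExp c ≠ x) :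
    emb K x s c = 0 := by
  refine Finsupp.mapDomain_of_notMem_range _ _ ?_
  rintro ⟨b, rfl⟩
  exact h (by ext; simp)

theorem emb_apply [DecidableEq ι] (x : ι →₀ ℕ) (s : DP K τ) (c : ι ⊕ τ →₀ ℕ) :
    emb K x s c = if fstExp c = x then s (sndExp c) else 0 := by
  split_ifs with h
  · conv_lhs => rw [← sumElim_fstExp_sndExp c, h]
    rw [emb_apply_sumElim]
  · exact emb_apply_of_ne x s c h

theorem emb_apply_sumElim_of_ne {x x' : ι →₀ ℕ} (h : x' ≠ x) (s : DP K τ) (b : τ →₀ ℕ) :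
    emb K x s (Finsupp.sumElim x' b) = 0 :=
  emb_apply_of_ne _ _ _ fun h' => h (by rw [← h']; ext; simp)

theorem emb_injective (x : ι →₀ ℕ) : Function.Injective (emb K x : DP K τ →ₗ[K] _) :=
  Finsupp.mapDomain_injective (sumElim_injective x)

theorem contract_X_inr_emb (j : τ) (x : ι →₀ ℕ) (s : DP K τ) :
    contract (X (Sum.inr j)) (emb K x s) = emb K x (contract (X j) s) := by
  classical
  ext c
  have h1 : fstExp (c + Finsupp.single (Sum.inr j) 1) = fstExp c := by ext; simp
  have h2 : sndExp (c + Finsupp.single (Sum.inr j) 1) = sndExp c + Finsupp.single j 1 := by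
    ext; simp [Finsupp.single_apply]
  rw [contract_X_apply, emb_apply, emb_apply, h1, h2, contract_X_apply]

theorem contract_X_inl_emb (i : ι) (x : ι →₀ ℕ) (s : DP K τ) :
    contract (X (Sum.inl i)) (emb K (x + Finsupp.single i 1) s) = emb K x s := by
  classical
  ext c
  have h1 : fstExp (c + Finsupp.single (Sum.inl i) 1) = fstExp c + Finsupp.single i 1 := by
    ext; simp [Finsupp.single_apply]
  have h2 : sndExp (c + Finsupp.single (Sum.inl i) 1) = sndExp c := by ext; simp
  rw [contract_X_apply, emb_apply, emb_apply, h1, h2]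
  simp only [add_left_inj]

theorem contract_X_inl_emb_of_eq_zero (i : ι) (x : ι →₀ ℕ) (hx : x i = 0) (s : DP K τ) :
    contract (X (Sum.inl i)) (emb K x s) = 0 := by
  ext c
  rw [contract_X_apply]
  refine emb_apply_of_ne _ _ _ fun h => ?_
  rw [← h] at hx
  simp at hx

theorem contract_rename_inr_emb (t : MvPolynomial τ K) (x : ι →₀ ℕ) (s : DP K τ) :
    contract (rename Sum.inr t) (emb K x s) = emb K x (contract t s) := by
  induction t using MvPolynomial.induction_on generalizing s with
  | C r => rw [rename_C, contract_C, contract_C, map_smul]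
  | add p q hp hq =>
    rw [map_add, map_add, LinearMap.add_apply, hp, hq, map_add, LinearMap.add_apply, map_add]
  | mul_X p j hp => rw [map_mul, rename_X, contract_mul, contract_mul, contract_X_inr_emb, hp]

theorem emb_mem_formsLE {x : ι →₀ ℕ} {s : DP K τ} {e e' : ℕ} (hs : s ∈ formsLE K τ e)
    (h : x.degree + e ≤ e') : emb K x s ∈ formsLE K (ι ⊕ τ) e' := by
  classical
  refine mem_formsLE.2 fun c hc => ?_
  rw [emb_apply] at hc
  split_ifs at hc with h1
  · have h2 := mem_formsLE.1 hs _ hc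
    have h3 : c.degree = (fstExp c).degree + (sndExp c).degree := by
      rw [← Finsupp.degree_mapDomain (Sum.inl : ι → ι ⊕ τ) (fstExp c),
        ← Finsupp.degree_mapDomain (Sum.inr : τ → ι ⊕ τ) (sndExp c), ← map_add]
      congr 1
      ext (i | j)
      · rw [Finsupp.add_apply, Finsupp.mapDomain_apply Sum.inl_injective,
          Finsupp.mapDomain_of_notMem_range _ _ (by simp), add_zero, fstExp_apply]
      · rw [Finsupp.add_apply, Finsupp.mapDomain_apply Sum.inr_injective,
          Finsupp.mapDomain_of_notMem_range _ _ (by simp), zero_add, sndExp_apply]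
    rw [h3, h1]
    omega
  · exact absurd rfl hc

theorem inclY_eq_emb {n m : ℕ} (s : DP K (Fin m)) :
    (inclY s : DP K (Fin (n + 1) ⊕ Fin m)) = emb K 0 s := by
  have : (Finsupp.mapDomain Sum.inr : (Fin m →₀ ℕ) → (Fin (n + 1) ⊕ Fin m →₀ ℕ)) =
      fun b => Finsupp.sumElim 0 b := by
    funext b
    ext (i | j)
    · rw [Finsupp.mapDomain_of_notMem_range _ _ (by simp)]
      simp
    · rw [Finsupp.mapDomain_apply Sum.inr_injective]
      simp
  rw [inclY, this, emb]

theorem dpMul_varX_inclY {n m : ℕ} (i : Fin (n + 1)) (s : DP K (Fin m)) :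
    dpMul (varX i) (inclY s) = emb K (Finsupp.single i 1) s := by
  classical
  rw [inclY_eq_emb, varX, dpMul, Finsupp.sum_single_index (by simp), emb, emb]
  simp only [Finsupp.lmapDomain_apply]
  rw [Finsupp.sum_mapDomain_index_inj (sumElim_injective 0), Finsupp.mapDomain]
  refine Finsupp.sum_congr fun b _ => ?_
  have h1 : Finsupp.single (Sum.inl i) 1 + Finsupp.sumElim 0 b =
      (Finsupp.sumElim (Finsupp.single i 1) b : Fin (n + 1) ⊕ Fin m →₀ ℕ) := by
    ext (k | k) <;> simp [Finsupp.single_apply]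
  -- The two factors share no variable, so every binomial coefficient is of the form C(k, k) or C(k,
  -- 0).
  have h2 : ((Finsupp.sumElim (Finsupp.single i 1) b : Fin (n + 1) ⊕ Fin m →₀ ℕ).prod fun s k =>
      k.choose ((Finsupp.single (Sum.inl i) 1 : Fin (n + 1) ⊕ Fin m →₀ ℕ) s)) = 1 := by
    refine Finset.prod_eq_one fun k _ => ?_
    rcases k with k | k
    · by_cases h : i = k <;> simp [h]
    · simp
  rw [h1, h2]
  simp

/-! ### Counting monomials -/

theorem finite_degree_le (τ : Type*) [Finite τ] (e : ℕ) : Finite {a : τ →₀ ℕ // a.degree ≤ e} :=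
  (Finsupp.finite_of_degree_le e).to_subtype

theorem finrank_formsLE (τ : Type*) (e : ℕ) :
    finrank K (formsLE K τ e) = Nat.card {a : τ →₀ ℕ // a.degree ≤ e} := by
  rw [formsLE,
    (Finsupp.supportedEquivFinsupp (R := K) (M := K) {a : τ →₀ ℕ | a.degree ≤ e}).finrank_eq]
  exact finrank_eq_nat_card_basis Finsupp.basisSingleOne

theorem finrank_forms (τ : Type*) (e : ℕ) :
    finrank K (forms K τ e) = Nat.card {a : τ →₀ ℕ // a.degree = e} := by
  rw [forms,
    (Finsupp.supportedEquivFinsupp (R := K) (M := K) {a : τ →₀ ℕ | a.degree = e}).finrank_eq]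
  exact finrank_eq_nat_card_basis Finsupp.basisSingleOne

theorem finrank_restrictTotalDegree (τ : Type*) (e : ℕ) :
    finrank K (restrictTotalDegree τ K e) = Nat.card {a : τ →₀ ℕ // a.degree ≤ e} := 
  finrank_eq_nat_card_basis (basisRestrictSupport K {a : τ →₀ ℕ | a.degree ≤ e})

instance (τ : Type*) [Finite τ] (e : ℕ) : FiniteDimensional K (formsLE K τ e) := by
  have := finite_degree_le τ e
  have : Finite ({a : τ →₀ ℕ | a.degree ≤ e} : Set _) := this
  exact Module.Finite.equiv (Finsupp.supportedEquivFinsupp (R := K) (M := K)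
    {a : τ →₀ ℕ | a.degree ≤ e}).symm

instance (τ : Type*) [Finite τ] (e : ℕ) : FiniteDimensional K (restrictTotalDegree τ K e) := by
  have := finite_degree_le τ e
  have : Finite ({a : τ →₀ ℕ | a.degree ≤ e} : Set _) := this
  exact Module.Finite.of_basis (basisRestrictSupport K {a : τ →₀ ℕ | a.degree ≤ e})

theorem card_degree_le_succ (τ : Type*) [Finite τ] (e : ℕ) :
    Nat.card {a : τ →₀ ℕ // a.degree ≤ e + 1} =
      Nat.card {a : τ →₀ ℕ // a.degree ≤ e} + Nat.card {a : τ →₀ ℕ // a.degree = e + 1} := by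
  have h1 : {a : τ →₀ ℕ | a.degree ≤ e + 1} = {a | a.degree ≤ e} ∪ {a | a.degree = e + 1} := by
    ext a
    simp only [Set.mem_ofPred_eq, Set.mem_union]
    omega
  have h2 : Disjoint {a : τ →₀ ℕ | a.degree ≤ e} {a | a.degree = e + 1} := by
    rw [Set.disjoint_left]
    intro a h h'
    simp only [Set.mem_ofPred_eq] at h h'
    omega
  have h3 : {a : τ →₀ ℕ | a.degree ≤ e}.Finite := Finsupp.finite_of_degree_le e
  have h4 : {a : τ →₀ ℕ | a.degree = e + 1}.Finite :=
    (Finsupp.finite_of_degree_le (e + 1)).subset fun _ h => le_of_eq h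
  exact (congrArg Set.ncard h1).trans (Set.ncard_union_eq h2 h3 h4)

theorem card_degree_eq (m e : ℕ) :
    Nat.card {a : Fin m →₀ ℕ // a.degree = e} = (m + e - 1).choose e := by
  rw [← Nat.multichoose_eq]
  have := Sym.card_sym_eq_multichoose (Fin m) e
  rw [Fintype.card_fin, ← Nat.card_eq_fintype_card] at this
  rw [← this]
  exact (Nat.card_congr (Sym.equivNatSum (Fin m) e)).symm

end Contract

end Perazzo

namespace Perazzo

open Module MvPolynomial

/-! ## Perazzo algebras -/

section Perazzo

variable {K ι τ : Type*} [Field K]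

section

variable [Fintype ι]

/-- The form `∑ X_i P_i + G`. -/
def perazzoForm (P : ι → DP K τ) (G : DP K τ) : DP K (ι ⊕ τ) :=
  ∑ i, emb K (Finsupp.single i 1) (P i) + emb K 0 G

variable (P : ι → DP K τ) (G : DP K τ)

theorem contract_rename_perazzoForm (t : MvPolynomial τ K) :
    contract (rename Sum.inr t) (perazzoForm P G) =
      perazzoForm (fun i => contract t (P i)) (contract t G) := by
  simp only [perazzoForm, map_add, map_sum, contract_rename_inr_emb]

theorem contract_X_inl_perazzoForm (i : ι) :
    contract (X (Sum.inl i)) (perazzoForm P G) = emb K 0 (P i) := by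
  classical
  rw [perazzoForm, map_add, map_sum, contract_X_inl_emb_of_eq_zero _ _ rfl, add_zero,
    Finset.sum_eq_single i]
  · simpa using contract_X_inl_emb i (0 : ι →₀ ℕ) (P i)
  · intro i' _ h
    exact contract_X_inl_emb_of_eq_zero _ _ (Finsupp.single_eq_of_ne h.symm) _
  · simp

theorem perazzoForm_zero (s : DP K τ) : perazzoForm (0 : ι → DP K τ) s = emb K 0 s := by
  simp [perazzoForm]

theorem perazzoForm_add_emb (s : DP K τ) :
    perazzoForm P G + emb K 0 s = perazzoForm P (G + s) := by
  rw [perazzoForm, perazzoForm, map_add, add_assoc]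

/-- The summands are supported on disjoint sets of monomials, told apart by their X-exponents. -/
theorem perazzoForm_eq_zero (h : perazzoForm P G = 0) : P = 0 ∧ G = 0 := by
  classical
  have hinj : ∀ i i' : ι, i' ≠ i → Finsupp.single i' 1 ≠ (Finsupp.single i 1 : ι →₀ ℕ) :=
    fun i i' h h' => h (Finsupp.single_left_injective one_ne_zero h')
  have hP : P = 0 := by
    ext i b
    have := DFunLike.congr_fun h (Finsupp.sumElim (Finsupp.single i 1) b)
    rw [perazzoForm, Finsupp.add_apply, Finsupp.finsetSum_apply, Finset.sum_eq_single i,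
      emb_apply_sumElim, emb_apply_sumElim_of_ne (by simp), add_zero] at this
    · exact this
    · intro i' _ hi'
      exact emb_apply_sumElim_of_ne (hinj i' i hi'.symm) _ _
    · simp
  refine ⟨hP, ?_⟩
  rw [hP, perazzoForm_zero] at h
  exact emb_injective 0 (h.trans (map_zero _).symm)

end

variable {P : ι → DP K τ} {G : DP K τ} {e : ℕ}

/-- A polynomial of degree at most `e` which annihilates all forms of degree `e` is zero. -/
theorem eq_zero_of_contract_forms_eq_zero [Nonempty τ] {t : MvPolynomial τ K}
    (ht : t ∈ restrictTotalDegree τ K e) (h : ∀ s ∈ forms K τ e, contract t s = 0) : t = 0 := by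
  classical
  obtain ⟨j⟩ := ‹Nonempty τ›
  ext a
  rw [coeff_zero]
  by_contra ha
  have hdeg : a.degree ≤ e := ht (MvPolynomial.mem_support_iff.2 ha)
  -- Padding a to degree e: the coefficient of X^[b] in t∘X^[b + a] is exactly the coefficient of t
  -- at a.
  let b := Finsupp.single j (e - a.degree)
  have h1 := DFunLike.congr_fun (h (Finsupp.single (b + a) 1)
    (Finsupp.single_mem_supported K _ (by
      simp only [Set.mem_ofPred_eq, b, map_add, Finsupp.degree_single]; omega))) b
  rw [contract_apply, Finset.sum_eq_single a, Finsupp.single_eq_same, mul_one] at h1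
  · exact ha h1
  · intro c _ hc
    rw [Finsupp.single_eq_of_ne (by simpa using hc), mul_zero]
  · intro h
    rw [notMem_support_iff.1 h, zero_mul]

/-- The linear map `(t, s) ↦ (g t) ∘ F + s`. -/
def paramMap (F : DP K (ι ⊕ τ)) (g : MvPolynomial (ι ⊕ τ) K) (e : ℕ) :
    (restrictTotalDegree τ K e × formsLE K τ e) →ₗ[K] DP K (ι ⊕ τ) :=
  ((contract.flip F) ∘ₗ LinearMap.mulLeft K g ∘ₗ (rename Sum.inr).toLinearMap ∘ₗ
    (restrictTotalDegree τ K e).subtype).coprod (emb K 0 ∘ₗ (formsLE K τ e).subtype)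

theorem paramMap_apply (F : DP K (ι ⊕ τ)) (g : MvPolynomial (ι ⊕ τ) K)
    (x : restrictTotalDegree τ K e × formsLE K τ e) :
    paramMap F g e x = contract (g * rename Sum.inr x.1.1) F + emb K 0 x.2.1 := rfl

theorem contract_mem_range_paramMap (F : DP K (ι ⊕ τ)) (g : MvPolynomial (ι ⊕ τ) K)
    {t : MvPolynomial τ K} (ht : t ∈ restrictTotalDegree τ K e) :
    contract (g * rename Sum.inr t) F ∈ LinearMap.range (paramMap F g e) :=
  ⟨(⟨t, ht⟩, 0), by rw [paramMap_apply]; simp⟩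

theorem emb_mem_range_paramMap (F : DP K (ι ⊕ τ)) (g : MvPolynomial (ι ⊕ τ) K)
    {s : DP K τ} (hs : s ∈ formsLE K τ e) :
    emb K 0 s ∈ LinearMap.range (paramMap F g e) :=
  ⟨(0, ⟨s, hs⟩), by rw [paramMap_apply]; simp⟩

theorem finrank_param (τ : Type*) [Finite τ] :
    finrank K (restrictTotalDegree τ K e × formsLE K τ e) =
      2 * Nat.card {a : τ →₀ ℕ // a.degree ≤ e} := by
  have : Module.Free K (formsLE K τ e) :=
    Module.Free.of_equiv (Finsupp.supportedEquivFinsupp (R := K) (M := K)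
      {a : τ →₀ ℕ | a.degree ≤ e}).symm
  have : Module.Free K (restrictTotalDegree τ K e) :=
    Module.Free.of_basis (basisRestrictSupport K {a : τ →₀ ℕ | a.degree ≤ e})
  rw [finrank_prod, finrank_restrictTotalDegree, finrank_formsLE, two_mul]

theorem mem_forms_of_span_eq (hP : Submodule.span K (Set.range P) = forms K τ (e + 1))
    (i : ι) : P i ∈ forms K τ (e + 1) :=
  hP ▸ Submodule.subset_span ⟨i, rfl⟩

section

variable [Fintype ι] (hP : Submodule.span K (Set.range P) = forms K τ (e + 1))
  (hG : G ∈ forms K τ (e + 2))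

include hP

/-- The part linear in the X's is the sum of the X_i (t∘P_i). Its vanishing makes t kill every form
of degree e + 1, as the P_i span them, so t = 0; then s = 0 remains. -/
theorem eq_zero_of_contract_add_emb_eq_zero [Nonempty τ] {t : MvPolynomial τ K} {s : DP K τ}
    (ht : t ∈ restrictTotalDegree τ K (e + 1))
    (h : contract (rename Sum.inr t) (perazzoForm P G) + emb K 0 s = 0) : t = 0 ∧ s = 0 := by
  rw [contract_rename_perazzoForm, perazzoForm_add_emb] at h
  obtain ⟨h1, h2⟩ := perazzoForm_eq_zero _ _ h
  have h0 : t = 0 := by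
    refine eq_zero_of_contract_forms_eq_zero ht fun s hs => ?_
    rw [← hP] at hs
    have : Submodule.span K (Set.range P) ≤ LinearMap.ker (contract t) := by
      rw [Submodule.span_le]
      rintro _ ⟨i, rfl⟩
      exact congrFun h1 i
    exact this hs
  refine ⟨h0, ?_⟩
  rwa [h0, map_zero, LinearMap.zero_apply, zero_add] at h2

theorem paramMap_one_injective [Nonempty τ] :
    Function.Injective (paramMap (perazzoForm P G) 1 (e + 1)) := by
  rw [injective_iff_map_eq_zero]
  rintro ⟨⟨t, ht⟩, ⟨s, hs⟩⟩ h
  rw [paramMap_apply, one_mul] at h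
  obtain ⟨rfl, rfl⟩ := eq_zero_of_contract_add_emb_eq_zero hP ht h
  rfl

/-- The product y_j t still has degree at most e + 1, and the polynomial ring is a domain. This
gives the lower bound on the rank of y_j. -/
theorem paramMap_X_inr_injective (j : τ) :
    Function.Injective (paramMap (perazzoForm P G) (X (Sum.inr j)) e) := by
  have : Nonempty τ := ⟨j⟩
  rw [injective_iff_map_eq_zero]
  rintro ⟨⟨t, ht⟩, ⟨s, hs⟩⟩ h
  rw [paramMap_apply, ← rename_X, ← map_mul] at h
  have ht' : X j * t ∈ restrictTotalDegree τ K (e + 1) := by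
    rw [mem_restrictTotalDegree] at ht ⊢
    exact (totalDegree_mul _ _).trans (by rw [totalDegree_X]; omega)
  obtain ⟨h1, rfl⟩ := eq_zero_of_contract_add_emb_eq_zero hP ht' h
  obtain rfl := (mul_eq_zero.1 h1).resolve_left (X_ne_zero j)
  rfl

/-- A Y-monomial of degree at most e + 1 is a contraction of one of degree exactly e + 1, which is a
combination of the P_i = x_i∘F. -/
theorem emb_mem_range_contract [Nonempty τ] {s : DP K τ} (hs : s ∈ formsLE K τ (e + 1)) :
    emb K 0 s ∈ LinearMap.range (contract.flip (perazzoForm P G)) := by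
  obtain ⟨j⟩ := ‹Nonempty τ›
  suffices formsLE K τ (e + 1) ≤
      (LinearMap.range (contract.flip (perazzoForm P G))).comap (emb K 0) from this hs
  rw [formsLE, Finsupp.supported_eq_span_single, Submodule.span_le]
  rintro _ ⟨c, hc, rfl⟩
  simp only [Set.mem_ofPred_eq] at hc
  let a := Finsupp.single j (e + 1 - c.degree)
  have h1 : contract (monomial a 1) (Finsupp.single (c + a) (1 : K)) = Finsupp.single c 1 := by
    ext c'
    rw [contract_monomial, one_smul, contractMonomial_apply]
    classical
    simp [Finsupp.single_apply]
  have h2 : Finsupp.single (c + a) (1 : K) ∈ forms K τ (e + 1) :=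
    Finsupp.single_mem_supported K _ (by
      simp only [Set.mem_ofPred_eq, a, map_add, Finsupp.degree_single]; omega)
  rw [← hP, Submodule.mem_span_range_iff_exists_fun] at h2
  obtain ⟨r, hr⟩ := h2
  refine ⟨rename Sum.inr (monomial a 1) * ∑ i, C (r i) * X (Sum.inl i), ?_⟩
  rw [LinearMap.flip_apply, contract_mul, map_sum, LinearMap.sum_apply]
  simp_rw [contract_mul, contract_C, contract_X_inl_perazzoForm, ← map_smul]
  rw [← map_sum, hr, contract_rename_inr_emb, h1]

theorem le_map_contract_X_inr_range (j : τ) :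
    LinearMap.range (paramMap (perazzoForm P G) (X (Sum.inr j)) e) ≤
      (LinearMap.range (contract.flip (perazzoForm P G))).map (contract (X (Sum.inr j))) := by
  have : Nonempty τ := ⟨j⟩
  rintro _ ⟨⟨⟨t, -⟩, ⟨s, hs⟩⟩, rfl⟩
  rw [paramMap_apply]
  refine Submodule.add_mem _ ⟨_, ⟨rename Sum.inr t, rfl⟩, ?_⟩ ?_
  · rw [LinearMap.flip_apply, contract_mul]
  · have hinj : Function.Injective fun c : τ →₀ ℕ => c + Finsupp.single j 1 := add_left_injective _
    -- Raising the exponent of Y_j by one is undone by contraction with y_j, and the degree stays at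
    -- most e + 1.
    refine ⟨emb K 0 (Finsupp.mapDomain (fun c => c + Finsupp.single j 1) s),
      emb_mem_range_contract hP (mem_formsLE.2 fun c hc => ?_), ?_⟩
    · by_cases h : c ∈ Set.range fun c : τ →₀ ℕ => c + Finsupp.single j 1
      · obtain ⟨c, rfl⟩ := h
        rw [Finsupp.mapDomain_apply hinj] at hc
        have := mem_formsLE.1 hs c hc
        simpa using this
      · exact absurd (Finsupp.mapDomain_of_notMem_range _ _ h) hc
    · rw [contract_X_inr_emb]
      congr 1
      ext c
      rw [contract_X_apply]
      exact Finsupp.mapDomain_apply hinj s c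

include hG

/-- Such a t kills the P_i, of degree e + 1, and sends G, of degree e + 2, to a constant. -/
theorem contract_rename_perazzoForm_of_le_degree {t : MvPolynomial τ K}
    (ht : ∀ a ∈ t.support, e + 2 ≤ a.degree) :
    ∃ s ∈ formsLE K τ 0, contract (rename Sum.inr t) (perazzoForm P G) = emb K 0 s := by
  refine ⟨contract t G, contract_mem_formsLE ht (forms_le_formsLE _ hG) (by omega), ?_⟩
  rw [contract_rename_perazzoForm, ← perazzoForm_zero]
  congr 1
  funext i
  exact contract_eq_zero_of_lt ht (forms_le_formsLE _ (mem_forms_of_span_eq hP i)) (by omega)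

theorem contract_rename_mem_range_paramMap (t : MvPolynomial τ K) :
    contract (rename Sum.inr t) (perazzoForm P G) ∈
      LinearMap.range (paramMap (perazzoForm P G) 1 (e + 1)) := by
  obtain ⟨t₁, ht₁, t₂, ht₂, rfl⟩ := exists_add_restrictTotalDegree t (e + 1)
  rw [map_add, map_add, LinearMap.add_apply]
  refine Submodule.add_mem _ ?_ ?_
  · have := contract_mem_range_paramMap (perazzoForm P G) 1 ht₁
    rwa [one_mul] at this
  · obtain ⟨s, hs, h⟩ := contract_rename_perazzoForm_of_le_degree hP hG ht₂
    rw [h]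
    exact emb_mem_range_paramMap _ _ (formsLE_mono (Nat.zero_le _) hs)

/-- The right side contains F and is stable under all variables: x_i turns t∘F into t∘P_i, y_j turns
it into (y_j t)∘F, and Y-elements stay Y-elements or vanish. -/
theorem range_contract_eq [Nonempty τ] :
    LinearMap.range (contract.flip (perazzoForm P G)) =
      LinearMap.range (paramMap (perazzoForm P G) 1 (e + 1)) := by
  classical
  apply le_antisymm
  · rintro _ ⟨f, rfl⟩
    rw [LinearMap.flip_apply]
    induction f using MvPolynomial.induction_on with
    | C r =>
      have := contract_rename_mem_range_paramMap hP hG (C r)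
      rwa [rename_C] at this
    | add p q hp hq =>
      rw [map_add, LinearMap.add_apply]
      exact Submodule.add_mem _ hp hq
    | mul_X p v hp =>
      obtain ⟨⟨⟨t, ht⟩, ⟨s, hs⟩⟩, h⟩ := hp
      rw [paramMap_apply, one_mul] at h
      rw [mul_comm, contract_mul, ← h, map_add]
      refine Submodule.add_mem _ ?_ ?_
      · rcases v with i | j
        · rw [← contract_mul, mul_comm, contract_mul, contract_X_inl_perazzoForm,
            contract_rename_inr_emb]
          exact emb_mem_range_paramMap _ _ (contract_mem_formsLE (k := 0)
            (fun _ _ => Nat.zero_le _) (forms_le_formsLE _ (mem_forms_of_span_eq hP i)) le_rfl)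
        · rw [← contract_mul, ← rename_X, ← map_mul]
          exact contract_rename_mem_range_paramMap hP hG _
      · rcases v with i | j
        · rw [contract_X_inl_emb_of_eq_zero _ _ rfl]
          exact Submodule.zero_mem _
        · rw [contract_X_inr_emb]
          exact emb_mem_range_paramMap _ _ (contract_mem_formsLE (k := 0)
            (fun _ _ => Nat.zero_le _) hs le_rfl)
  · rintro _ ⟨⟨⟨t, ht⟩, ⟨s, hs⟩⟩, rfl⟩
    rw [paramMap_apply]
    exact Submodule.add_mem _ ⟨_, rfl⟩ (emb_mem_range_contract hP hs)

/-- The image of multiplication by a linear form. -/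
theorem map_contract_range_le [Nonempty τ] [Fintype τ] (a : ι ⊕ τ → K) :
    (LinearMap.range (contract.flip (perazzoForm P G))).map (contract (∑ v, C (a v) * X v)) ≤
      LinearMap.range (paramMap (perazzoForm P G) (∑ v, C (a v) * X v) e) := by
  classical
  have hsum : ∀ p : DP K (ι ⊕ τ), (∀ v, contract (X v) p ∈
      LinearMap.range (paramMap (perazzoForm P G) (∑ v, C (a v) * X v) e)) →
      contract (∑ v, C (a v) * X v) p ∈
        LinearMap.range (paramMap (perazzoForm P G) (∑ v, C (a v) * X v) e) := by
    intro p hp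
    rw [map_sum, LinearMap.sum_apply]
    refine Submodule.sum_mem _ fun v _ => ?_
    rw [contract_mul, contract_C]
    exact Submodule.smul_mem _ _ (hp v)
  rw [range_contract_eq hP hG]
  rintro _ ⟨_, ⟨⟨⟨t, -⟩, ⟨s, hs⟩⟩, rfl⟩, rfl⟩
  rw [paramMap_apply, one_mul, map_add]
  refine Submodule.add_mem _ ?_ (hsum _ fun v => ?_)
  -- The part of degree at most e is already parametrised. The rest has order at least e + 1: x_i
  -- sends t₂∘F to t₂∘P_i, while y_j t₂ has order at least e + 2 and kills every P_i. In both cases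
  -- only a constant is left.
  · obtain ⟨t₁, ht₁, t₂, ht₂, rfl⟩ := exists_add_restrictTotalDegree t e
    rw [map_add, map_add, LinearMap.add_apply, map_add]
    refine Submodule.add_mem _ ?_ (hsum _ fun v => ?_)
    · rw [← contract_mul]
      exact contract_mem_range_paramMap _ _ ht₁
    · rcases v with i | j
      · rw [← contract_mul, mul_comm, contract_mul, contract_X_inl_perazzoForm,
          contract_rename_inr_emb]
        exact emb_mem_range_paramMap _ _ (contract_mem_formsLE ht₂
          (forms_le_formsLE _ (mem_forms_of_span_eq hP i)) (by omega))
      · rw [contract_rename_perazzoForm, ← rename_X, contract_rename_perazzoForm]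
        have h0 : (fun i => contract (X j) (contract t₂ (P i))) = 0 := by
          funext i
          have : contract t₂ (P i) ∈ formsLE K τ 0 := contract_mem_formsLE ht₂
            (forms_le_formsLE _ (mem_forms_of_span_eq hP i)) (by omega)
          exact contract_eq_zero_of_lt (le_degree_of_mem_support_X j) this zero_lt_one
        rw [h0, perazzoForm_zero]
        have : contract t₂ G ∈ formsLE K τ 1 := contract_mem_formsLE ht₂
            (forms_le_formsLE _ hG) (by omega)
        exact emb_mem_range_paramMap _ _
          (contract_mem_formsLE (le_degree_of_mem_support_X j) this (by omega))
  · rcases v with i | j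
    · rw [contract_X_inl_emb_of_eq_zero _ _ rfl]
      exact Submodule.zero_mem _
    · rw [contract_X_inr_emb]
      exact emb_mem_range_paramMap _ _
        (contract_mem_formsLE (le_degree_of_mem_support_X j) hs (by omega))

/-! ### Dimension of A_F and largest rank of a linear form -/

theorem finrank_range_contract [Nonempty τ] [Finite τ] :
    finrank K (LinearMap.range (contract.flip (perazzoForm P G))) =
      2 * Nat.card {a : τ →₀ ℕ // a.degree ≤ e + 1} := by
  rw [range_contract_eq hP hG, LinearMap.finrank_range_of_inj (paramMap_one_injective hP),
    finrank_param]

theorem finite_range_contract [Nonempty τ] [Finite τ] :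
    FiniteDimensional K (LinearMap.range (contract.flip (perazzoForm P G))) := by
  rw [range_contract_eq hP hG]
  infer_instance

theorem finrank_map_contract_range_le [Nonempty τ] [Fintype τ] (a : ι ⊕ τ → K) :
    finrank K ((LinearMap.range (contract.flip (perazzoForm P G))).map
      (contract (∑ v, C (a v) * X v))) ≤ 2 * Nat.card {a : τ →₀ ℕ // a.degree ≤ e} := by
  refine (Submodule.finrank_mono (map_contract_range_le hP hG a)).trans ?_
  rw [← finrank_param (K := K)]
  exact LinearMap.finrank_range_le _

theorem le_finrank_map_contract_X_inr_range [Finite τ] (j : τ) :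
    2 * Nat.card {a : τ →₀ ℕ // a.degree ≤ e} ≤
      finrank K ((LinearMap.range (contract.flip (perazzoForm P G))).map
        (contract (X (Sum.inr j)))) := by
  have : Nonempty τ := ⟨j⟩
  have := finite_range_contract hP hG
  refine le_trans ?_ (Submodule.finrank_mono (le_map_contract_X_inr_range hP j))
  rw [LinearMap.finrank_range_of_inj (paramMap_X_inr_injective hP j), finrank_param]

theorem perazzoForm_mem_formsLE : perazzoForm P G ∈ formsLE K (ι ⊕ τ) (e + 2) := by
  refine Submodule.add_mem _ (Submodule.sum_mem _ fun i _ => ?_) ?_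
  · exact emb_mem_formsLE (forms_le_formsLE _ (mem_forms_of_span_eq hP i))
      (by rw [Finsupp.degree_single]; omega)
  · exact emb_mem_formsLE (forms_le_formsLE _ hG) (by simp)

end

end Perazzo

end Perazzo

namespace Perazzo

open Module MvPolynomial

/-! ### From contraction to multiplication in A_F; the generic Jordan type -/

section Algebra

variable {K σ : Type*} [Field K]

/-- The embedding `g ↦ g ∘ F` of `A_F` in the divided power algebra. -/
def algEmb (F : DP K σ) : Alg F →ₗ[K] DP K σ :=
  Submodule.liftQ ((annIdeal F).restrictScalars K) (contract.flip F) fun _ h => h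

theorem algEmb_mk (F : DP K σ) (g : MvPolynomial σ K) :
    algEmb F (Ideal.Quotient.mk (annIdeal F) g) = contract g F := rfl

theorem algEmb_injective (F : DP K σ) : Function.Injective (algEmb F) := by
  rw [injective_iff_map_eq_zero]
  intro x hx
  obtain ⟨g, rfl⟩ := Ideal.Quotient.mk_surjective x
  exact Ideal.Quotient.eq_zero_iff_mem.2 hx

theorem range_algEmb (F : DP K σ) : LinearMap.range (algEmb F) =
    LinearMap.range (contract.flip F) :=
  Submodule.range_liftQ _ _ _

theorem finrank_alg (F : DP K σ) :
    finrank K (Alg F) = finrank K (LinearMap.range (contract.flip F)) := by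
  rw [← range_algEmb, LinearMap.finrank_range_of_inj (algEmb_injective F)]

/-- The injection `algEmb F` intertwines multiplication by f with contraction by f. -/
theorem finrank_range_mulLeft_mk (F : DP K σ) (f : MvPolynomial σ K) :
    finrank K (LinearMap.range (LinearMap.mulLeft K (Ideal.Quotient.mk (annIdeal F) f))) =
      finrank K ((LinearMap.range (contract.flip F)).map (contract f)) := by
  have h : algEmb F ∘ₗ LinearMap.mulLeft K (Ideal.Quotient.mk (annIdeal F) f) =
      contract f ∘ₗ algEmb F := by
    refine LinearMap.ext fun x => ?_
    obtain ⟨g, rfl⟩ := Ideal.Quotient.mk_surjective x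
    rw [LinearMap.comp_apply, LinearMap.mulLeft_apply, ← map_mul, algEmb_mk, contract_mul]
    rfl
  rw [← range_algEmb, ← LinearMap.range_comp, ← h, LinearMap.range_comp]
  exact (Submodule.equivMapOfInjective (algEmb F) (algEmb_injective F) _).finrank_eq

/-- The linear form with given coefficients. -/
def linearForm (F : DP K σ) [Fintype σ] : (σ → K) →ₗ[K] Alg F :=
  (Ideal.Quotient.mkₐ K (annIdeal F)).toLinearMap ∘ₗ Fintype.linearCombination K X

theorem linearForm_apply (F : DP K σ) [Fintype σ] (a : σ → K) :
    linearForm F a = Ideal.Quotient.mk (annIdeal F) (∑ v, C (a v) * X v) := by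
  simp only [linearForm, LinearMap.comp_apply, Fintype.linearCombination_apply, smul_eq_C_mul]
  rfl

theorem range_linearForm (F : DP K σ) [Fintype σ] :
    LinearMap.range (linearForm F) = linearForms F := by
  rw [linearForm, LinearMap.range_comp, Fintype.range_linearCombination,
    ← homogeneousSubmodule_one_eq_span_X, linearForms]

theorem linearForm_pow_eq_zero (F : DP K σ) [Fintype σ] {e : ℕ} (hF : F ∈ formsLE K σ e)
    (a : σ → K) : linearForm F a ^ (e + 1) = 0 := by
  rw [linearForm_apply, ← map_pow, Ideal.Quotient.eq_zero_iff_mem]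
  have hhom : (∑ v, C (a v) * X v : MvPolynomial σ K).IsHomogeneous 1 :=
    IsHomogeneous.sum _ _ _ fun v _ => by
      simpa using (isHomogeneous_C σ (a v)).mul (isHomogeneous_X K v)
  have h := hhom.pow (e + 1)
  refine contract_eq_zero_of_lt (k := e + 1) (fun c hc => ?_) hF (Nat.lt_succ_self e)
  have := h (MvPolynomial.mem_support_iff.1 hc)
  rw [Pi.one_def, ← Finsupp.degree_eq_weight_one] at this
  omega

/-- The generic linear Jordan type of `A_F` exists, and it is the Jordan type of a linear form whose
rank is the largest possible. -/
theorem exists_isGenericLinearJordanType [Infinite K] [Fintype σ] (F : DP K σ)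
    [FiniteDimensional K (Alg F)] {e : ℕ} (hF : F ∈ formsLE K σ e) :
    ∃ a : σ → K, (∀ a', finrank K (LinearMap.range (LinearMap.mulLeft K (linearForm F a'))) ≤
        finrank K (LinearMap.range (LinearMap.mulLeft K (linearForm F a)))) ∧
      ∃ P, IsJordanType (LinearMap.mulLeft K (linearForm F a)) P ∧
        IsGenericLinearJordanType F P := by
  obtain ⟨a, ha⟩ := exists_forall_finrank_range_pow_le
    (LinearMap.mul K (Alg F) ∘ₗ linearForm F) (e + 2)
  have hrank : ∀ k a', finrank K (LinearMap.range (LinearMap.mulLeft K (linearForm F a') ^ k)) ≤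
      finrank K (LinearMap.range (LinearMap.mulLeft K (linearForm F a) ^ k)) := by
    intro k a'
    -- Only finitely many powers need a generic choice: ℓ^(e + 1) = 0 for every linear form.
    rcases lt_or_ge k (e + 2) with hk | hk
    · exact ha k hk a'
    · have : LinearMap.mulLeft K (linearForm F a') ^ k = 0 := by
        rw [LinearMap.pow_mulLeft, pow_eq_zero_of_le (by omega) (linearForm_pow_eq_zero F hF a'),
          LinearMap.mulLeft_zero_eq_zero]
      rw [this, LinearMap.range_zero, finrank_bot]
      exact Nat.zero_le _
  have hnil : IsNilpotent (LinearMap.mulLeft K (linearForm F a)) := ⟨e + 1, by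
    rw [LinearMap.pow_mulLeft, linearForm_pow_eq_zero F hF a, LinearMap.mulLeft_zero_eq_zero]⟩
  obtain ⟨P, hP⟩ := exists_isJordanType _ hnil
  refine ⟨a, fun a' => by have := hrank 1 a'; rwa [pow_one, pow_one] at this, P, hP,
    ⟨_, ?_, hP⟩, ?_⟩
  · rw [← range_linearForm]
    exact ⟨a, rfl⟩
  · intro ℓ hℓ Q hQ
    rw [← range_linearForm] at hℓ
    obtain ⟨a', rfl⟩ := hℓ
    refine dominates_of_sum_tsub_le fun j => ?_
    rw [← hP.finrank_range_pow, ← hQ.finrank_range_pow]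
    exact hrank j a'

theorem IsGenericLinearJordanType.unique {F : DP K σ} {P Q : Nat.Partition (finrank K (Alg F))}
    (hP : IsGenericLinearJordanType F P) (hQ : IsGenericLinearJordanType F Q) : P = Q := by
  obtain ⟨⟨ℓ, hℓ, h⟩, hP⟩ := hP
  obtain ⟨⟨ℓ', hℓ', h'⟩, hQ⟩ := hQ
  exact eq_of_dominates (hP ℓ' hℓ' Q h') (hQ ℓ hℓ P h)

theorem IsFullPerazzoForm.exists_eq_perazzoForm {n m d : ℕ} {F : DP K (Fin (n + 1) ⊕ Fin m)}
    (hF : IsFullPerazzoForm d F) :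
    ∃ (P : Fin (n + 1) → DP K (Fin m)) (G : DP K (Fin m)), LinearIndependent K P ∧
      Submodule.span K (Set.range P) = forms K (Fin m) (d - 1) ∧ G ∈ forms K (Fin m) d ∧
      F = perazzoForm P G := by
  obtain ⟨P, G, h1, h2, h3, rfl⟩ := hF
  refine ⟨P, G, h1, h2, h3, ?_⟩
  rw [inclY_eq_emb, perazzoForm]
  simp only [dpMul_varX_inclY]

end Algebra

end Perazzo
end

theorem corollary3p3 {K : Type*} [Field K] [Infinite K] {n m d : ℕ} (hm : 2 ≤ m) (hd : 3 ≤ d)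
    (hchar : ringChar K = 0 ∨ d < ringChar K)
    (F : Perazzo.DP K (Fin (n + 1) ⊕ Fin m)) (hF : Perazzo.IsFullPerazzoForm d F) :
    n + 1 = (d + m - 2).choose (m - 1) ∧
    (∃! P : Nat.Partition (Module.finrank K (Perazzo.Alg F)),
      Perazzo.IsGenericLinearJordanType F P) ∧
    ∀ P : Nat.Partition (Module.finrank K (Perazzo.Alg F)),
      Perazzo.IsGenericLinearJordanType F P → P.parts.card = 2 * (n + 1) := by
  obtain ⟨P, G, hli, hspan, hG, rfl⟩ := hF.exists_eq_perazzoForm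
  obtain ⟨e, rfl⟩ : ∃ e, d = e + 2 := ⟨d - 2, by omega⟩
  have hspan : Submodule.span K (Set.range P) = Perazzo.forms K (Fin m) (e + 1) := hspan
  have hcard : n + 1 = Nat.card {a : Fin m →₀ ℕ // a.degree = e + 1} := by
    rw [← Perazzo.finrank_forms (K := K), ← hspan, finrank_span_eq_card hli, Fintype.card_fin]
  have : Nonempty (Fin m) := ⟨⟨0, by omega⟩⟩
  have hfin := Perazzo.finite_range_contract hspan hG
  rw [← Perazzo.range_algEmb] at hfin
  have : FiniteDimensional K (Perazzo.Alg (Perazzo.perazzoForm P G)) :=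
    Module.Finite.equiv (LinearEquiv.ofInjective _
      (Perazzo.algEmb_injective (Perazzo.perazzoForm P G))).symm
  obtain ⟨a, ha, Q, hQ, hgen⟩ := Perazzo.exists_isGenericLinearJordanType
    (Perazzo.perazzoForm P G) (Perazzo.perazzoForm_mem_formsLE hspan hG)
  refine ⟨?_, ⟨Q, hgen, fun Q' h => h.unique hgen⟩, fun Q' h => ?_⟩
  · rw [hcard, Perazzo.card_degree_eq, show e + 2 + m - 2 = e + 1 + (m - 1) by omega,
      show m + (e + 1) - 1 = e + 1 + (m - 1) by omega]
    exact Nat.choose_symm_add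
  · obtain rfl := h.unique hgen
    have h1 := hQ.finrank_range_add_card
    -- The rank of the generic form is squeezed: `h2` bounds it above by 2 N_e, while maximality
    -- against the first y-variable (`h3`, `h4`) bounds it below by the same number.
    have h2 := Perazzo.finrank_map_contract_range_le hspan hG a
    have h3 := Perazzo.le_finrank_map_contract_X_inr_range hspan hG ⟨0, by omega⟩
    have h4 := ha (Pi.single (Sum.inr ⟨0, by omega⟩) 1)
    have h5 : ∑ v, MvPolynomial.C ((Pi.single (Sum.inr ⟨0, by omega⟩) 1 : _ → K) v) *
        (MvPolynomial.X v : MvPolynomial (Fin (n + 1) ⊕ Fin m) K) =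
        MvPolynomial.X (Sum.inr ⟨0, by omega⟩) := by
      rw [Finset.sum_eq_single (Sum.inr ⟨0, by omega⟩)]
      · simp
      · intro v _ hv
        rw [Pi.single_eq_of_ne hv, map_zero, zero_mul]
      · simp
    rw [Perazzo.linearForm_apply, Perazzo.linearForm_apply, h5, Perazzo.finrank_range_mulLeft_mk,
      Perazzo.finrank_range_mulLeft_mk] at h4
    rw [Perazzo.linearForm_apply, Perazzo.finrank_range_mulLeft_mk] at h1
    have h6 := Perazzo.finrank_alg (Perazzo.perazzoForm P G)
    rw [Perazzo.finrank_range_contract hspan hG, Perazzo.card_degree_le_succ, ← hcard] at h6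
    omega
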